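/- Consider a finite constrained Markov decision process: nonempty finite sets $\mathcal S$ (states) and $\mathcal A$ (actions), a transition kernel $P(\cdot\mid s,a)$, a discount factor $\gamma\in(0,1)$, an initial distribution $\rho$ on $\mathcal S$, strictly positive reward functions $r_0,r_1,\dots,r_m$ on $\mathcal S\times\mathcal A$, and thresholds $c\in\mathbb R^m$. For a stationary policy $\pi\in\Pi$ let $V_i^\pi(s)=\mathbb E\left[\sum_{t\ge0}\gamma^t r_i(s_t,a_t)\mid s_0=s\right]$ with $a_t\sim\pi(\cdot\mid s_t)$, $s_{t+1}\sim P(\cdot\mid s_t,a_t)$, and $V_i^\pi(\rho)=\mathbb E_{s_0\sim\rho}[V_i^\pi(s_0)]$, $V^\pi(\rho)=(V_1^\pi(\rho),\dots,V_m^\pi(\rho))^\top$, and let $\mathcal H(\pi)=-\mathbb E_{s_0\sim\rho}\left[\sum_{t\ge0}\gamma^t\log\pi(a_t\mid s_t)\right]$. For $\tau>0$ and $\lambda\in\mathbb R^m$ put $$\mathcal L_\tau(\pi,\lambda)=V_0^\pi(\rho)+\langle\lambda,V^\pi(\rho)-c\rangle+\tau\mathcal H(\pi),\qquad d_\tau(\lambda)=\max_{\pi\in\Pi}\mathcal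 L_\tau(\pi,\lambda).$$ Let $r_{i,\max}=\max_{s,a}r_i(s,a)$, $R_{\max}=\sqrt{\sum_{i=1}^m r_{i,\max}^2}$, let $\xi>0$, and let $\Lambda=\{\lambda\in\mathbb R^m_+:\ \|\lambda\|_1\le B_\lambda\}$ with $B_\lambda=\frac{r_{0,\max}+\log|\mathcal A|}{(1-\gamma)\xi}$. Fix $\tau>0$ and suppose that 1. (uniqueness) for every $\lambda\in\Lambda$ there is exactly one policy $\pi^*_{\tau,\lambda}$ that maximizes $\mathcal L_\tau(\cdot,\lambda)$ over $\Pi$; 2. (uniform ergodicity) there are constants $C_M>0$ and $0<\beta<1$ such that for every $\lambda\in\Lambda$ the state chain induced by $\pi^*_{\tau,\lambda}$ has a stationary distribution $\chi$ with $\sup_{s\in\mathcal S}d_{TV}\left(\mathbb P(s_t\in\cdot\mid s_0=s),\chi\right)\le C_M\beta^t$ for all $t\ge0$, where $d_{TV}(p,q)=\frac12\sum_s|p(s)-q(s)|$; if $|\mathcal S|=1$, the constant is chosen with $C_M\ge1$. Then $d_\tau$ is differentiable at every point of $\Lambda$ and $L_d$-smooth on $\Lambda$: $$\left\|\nabla d_\tau(\lambda)-\nabla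 d_\tau(\lambda')\right\|_2\le L_d\left\|\lambda-\lambda'\right\|_2\qquad\text{for all }\lambda,\lambda'\in\Lambda,$$ where $$L_d=\frac{R_{\max}^2L_\beta}{(1-\gamma)^2\tau},\qquad L_\beta=\left\lceil\log_\beta\left(C_M^{-1}\right)\right\rceil+(1-\beta)^{-1}+1.$$ -/

import Mathlib

open MeasureTheory ProbabilityTheory
open scoped Gradient

/-- A finite discounted constrained Markov decision process with states `S`, actions `A` and
`m` constraints: transition kernel `P`, discount factor `γ`, initial distribution `ρ`, positive
rewards `r 0, …, r m` (`r 0` is the objective, `r 1, …, r m` are the constraint rewards) and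
constraint thresholds `c`. -/
structure CMDP (S A : Type*) (m : ℕ) where
  /-- transition kernel: `P s a` is the law of the next state -/
  P : S → A → PMF S
  /-- discount factor -/
  γ : ℝ
  γ_pos : 0 < γ
  γ_lt_one : γ < 1
  /-- distribution of the initial state -/
  ρ : PMF S
  /-- reward functions -/
  r : Fin (m + 1) → S → A → ℝ
  r_pos : ∀ i s a, 0 < r i s a
  /-- constraint thresholds -/
  c : EuclideanSpace ℝ (Fin m)

/-- Stationary policies: `π s` is the distribution `π(· | s)` over actions. -/
abbrev Policy (S A : Type*) := S → PMF A

namespace CMDP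

noncomputable section

variable {S A : Type*} {m : ℕ}

/-- Law of `(s, a)` with `s ∼ μ` and `a ∼ π(· | s)`. -/
def saLaw (π : Policy S A) (μ : PMF S) : PMF (S × A) :=
  μ.bind fun s => (π s).map (Prod.mk s)

/-- One step of the state chain under `π`: the law of `s_{t+1}` given `s_t = s`. -/
def stateStep (M : CMDP S A m) (π : Policy S A) (s : S) : PMF S :=
  (π s).bind (M.P s)

/-- The law of `s_t` under `π` given `s_0 = s`. -/
def stateLaw (M : CMDP S A m) (π : Policy S A) (s : S) (t : ℕ) : PMF S :=
  (fun μ : PMF S => μ.bind (M.stateStep π))^[t] (PMF.pure s)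

/-- `χ` is a stationary distribution of the state chain under `π`. -/
def IsStationary (M : CMDP S A m) (π : Policy S A) (χ : PMF S) : Prop :=
  χ.bind (M.stateStep π) = χ

section trajectories

variable [Fintype S] [Fintype A] [MeasurableSpace S] [MeasurableSingletonClass S]
  [MeasurableSpace A] [MeasurableSingletonClass A]

/-- The Markov kernel on state-action pairs, `(s, a) ↦ law of (s', a')` with `s' ∼ P(· | s, a)` and
`a' ∼ π(· | s')`. -/
def saKernel (M : CMDP S A m) (π : Policy S A) : Kernel (S × A) (S × A) :=
  Kernel.ofFunOfCountable fun x => (saLaw π (M.P x.1 x.2)).toMeasure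

instance (M : CMDP S A m) (π : Policy S A) : IsMarkovKernel (M.saKernel π) :=
  ⟨fun x => PMF.toMeasure.isProbabilityMeasure (saLaw π (M.P x.1 x.2))⟩

/-- The step-`n` kernel as a function of the history; it depends on the last pair only. -/
def historyKernel (M : CMDP S A m) (π : Policy S A) (n : ℕ) :
    Kernel ((i : Finset.Iic n) → (fun _ : ℕ => S × A) i) (S × A) :=
  (M.saKernel π).comap (fun h => h ⟨n, Finset.mem_Iic.2 le_rfl⟩) (measurable_pi_apply _)

instance (M : CMDP S A m) (π : Policy S A) (n : ℕ) : IsMarkovKernel (M.historyKernel π n) := by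
  unfold historyKernel; infer_instance

/-- The law of the trajectory `(s_0, a_0), (s_1, a_1), …` with `s_0 ∼ μ`, `a_t ∼ π(· | s_t)`,
`s_{t+1} ∼ P(· | s_t, a_t)`. -/
def trajLaw (M : CMDP S A m) (π : Policy S A) (μ : PMF S) : Measure (ℕ → S × A) :=
  Kernel.trajMeasure (X := fun _ => S × A) (saLaw π μ).toMeasure (M.historyKernel π)

/-- `𝔼 [∑_t γ^t f(s_t, a_t)]` along the trajectory started from `s_0 ∼ μ` and following `π`. -/
def discounted (M : CMDP S A m) (π : Policy S A) (μ : PMF S) (f : S → A → ℝ) : ℝ :=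
  ∫ ω, ∑' t : ℕ, M.γ ^ t * f (ω t).1 (ω t).2 ∂(M.trajLaw π μ)

/-- The value function `V_i^π(s)`. -/
def stateValue (M : CMDP S A m) (π : Policy S A) (i : Fin (m + 1)) (s : S) : ℝ :=
  M.discounted π (PMF.pure s) (M.r i)

/-- `V_i^π(ρ)`, the mean of `V_i^π(s_0)` over `s_0 ∼ ρ`. -/
def value (M : CMDP S A m) (π : Policy S A) (i : Fin (m + 1)) : ℝ :=
  ∑ s, (M.ρ s).toReal * M.stateValue π i s

/-- The vector `(V_1^π(ρ), …, V_m^π(ρ))`. -/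
def constraintValue (M : CMDP S A m) (π : Policy S A) : EuclideanSpace ℝ (Fin m) :=
  WithLp.toLp 2 fun i => M.value π i.succ

/-- The discounted entropy `- 𝔼 [∑_t γ^t log π(a_t | s_t)]` of the policy `π`. -/
def entropy (M : CMDP S A m) (π : Policy S A) : ℝ :=
  -M.discounted π M.ρ fun s a => Real.log (π s a).toReal

/-- The entropy-regularized Lagrange function. -/
def lagrangian (M : CMDP S A m) (τ : ℝ) (π : Policy S A) (lam : EuclideanSpace ℝ (Fin m)) : ℝ :=
  M.value π 0 + inner ℝ lam (M.constraintValue π - M.c) + τ * M.entropy π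

/-- `π` maximizes the entropy-regularized Lagrange function over all stationary policies. -/
def IsOptimal (M : CMDP S A m) (τ : ℝ) (lam : EuclideanSpace ℝ (Fin m)) (π : Policy S A) : Prop :=
  ∀ π' : Policy S A, M.lagrangian τ π' lam ≤ M.lagrangian τ π lam

/-- The dual function `d_τ(λ)`, the maximum over `π` of the entropy-regularized Lagrange function. -/
def dual (M : CMDP S A m) (τ : ℝ) (lam : EuclideanSpace ℝ (Fin m)) : ℝ :=
  ⨆ π : Policy S A, M.lagrangian τ π lam

end trajectories

/-- `r_{i,max}`. -/
def rMax (M : CMDP S A m) (i : Fin (m + 1)) : ℝ :=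
  ⨆ x : S × A, M.r i x.1 x.2

/-- `R_max`; the objective reward `r 0` is not included. -/
def RMax (M : CMDP S A m) : ℝ :=
  √(∑ i : Fin m, M.rMax i.succ ^ 2)

/-- The radius `B_λ` for Slater constant `ξ`. -/
def dualRadius [Fintype A] (M : CMDP S A m) (ξ : ℝ) : ℝ :=
  (M.rMax 0 + Real.log (Fintype.card A)) / ((1 - M.γ) * ξ)

/-- The set `Λ` of nonnegative multipliers with `ℓ¹`-norm at most `B_λ`. -/
def dualDomain [Fintype A] (M : CMDP S A m) (ξ : ℝ) : Set (EuclideanSpace ℝ (Fin m)) :=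
  {lam | (∀ i, 0 ≤ lam i) ∧ ∑ i, |lam i| ≤ M.dualRadius ξ}

/-- Total variation distance of two distributions on a finite set. -/
def tvDist [Fintype S] (p q : PMF S) : ℝ :=
  (1 / 2) * ∑ s, |(p s).toReal - (q s).toReal|

/-- The state chain under `π` is uniformly ergodic with constants `C` and `β`. -/
def UniformlyErgodic [Fintype S] (M : CMDP S A m) (π : Policy S A) (C β : ℝ) : Prop :=
  ∃ χ : PMF S, M.IsStationary π χ ∧ ∀ (t : ℕ) (s : S), tvDist (M.stateLaw π s t) χ ≤ C * β ^ t

/-- `L_β`. -/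
def Lβ (C β : ℝ) : ℝ :=
  (⌈Real.logb β C⁻¹⌉ : ℝ) + (1 - β)⁻¹ + 1

/-- The smoothness constant `L_d`. -/
def Ld (M : CMDP S A m) (τ C β : ℝ) : ℝ :=
  M.RMax ^ 2 * Lβ C β / ((1 - M.γ) ^ 2 * τ)

end

end CMDP

/-! The maximiser of the Lagrangian is explicit. With reward `R = r₀ + ∑ λᵢ rᵢ`, the soft Bellman
operator is a `γ`-contraction; its fixed point `softValue` is the optimal regularised value,
attained by the Gibbs policy `softPolicy`, so `d_τ(λ) = 𝔼_ρ[softValue] - ⟨λ, c⟩` (`dual_eq`). By an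
envelope argument (`hasFDerivAt_softValue`) the derivative of `softValue` in a direction `h` is the
ordinary value of `h` under the soft policy. Hence `∇d_τ(λ)` is the constraint value of that policy
minus `c`.

Differentiating once more along a segment (`hasDerivAt_polValue_softPolicy_line`) gives a discounted
sum of the covariances, under `π(· | s)`, of two action value functions, divided by `τ`. A
covariance is at most a quarter of the product of the oscillations. Ergodicity makes value functions
nearly independent of the starting state, so the oscillation of `Q` for the reward `∑ vᵢ rᵢ` is at
most `‖v‖ R_max K` with `K = 1 + γ ∑ γ^t min(1, 2Cβ^t)`. The second derivative is thus at most `‖u‖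
‖w‖ R_max² K² / (4τ(1 - γ))`. Bounding one factor `K` by `4 L_β` and the other by `1/(1 - γ)` yields
`L_d`; the mean value inequality on the convex set `Λ`, tested against `u = ∇d_τ(λ) - ∇d_τ(λ')`,
concludes. -/

namespace PMF

/-! ### Expectations under distributions on finite types. -/

/-- The mean of a real function under a distribution on a finite type. -/
noncomputable def expect {α : Type*} [Fintype α] (p : PMF α) (f : α → ℝ) : ℝ :=
  ∑ x, (p x).toReal * f x

section expect

variable {α β : Type*} [Fintype α]

lemma sum_toReal (p : PMF α) : ∑ x, (p x).toReal = 1 := by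
  rw [← ENNReal.toReal_sum (fun a _ => p.apply_ne_top a), ← tsum_fintype (L := .unconditional _),
    p.tsum_coe, ENNReal.toReal_one]

lemma expect_const (p : PMF α) (c : ℝ) : p.expect (fun _ => c) = c := by
  rw [expect, ← Finset.sum_mul, p.sum_toReal, one_mul]

lemma expect_add (p : PMF α) (f g : α → ℝ) :
    p.expect (fun x => f x + g x) = p.expect f + p.expect g := by
  simp only [expect, mul_add, Finset.sum_add_distrib]

lemma expect_sub (p : PMF α) (f g : α → ℝ) :
    p.expect (fun x => f x - g x) = p.expect f - p.expect g := by
  simp only [expect, mul_sub, Finset.sum_sub_distrib]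

lemma expect_const_mul (p : PMF α) (c : ℝ) (f : α → ℝ) :
    p.expect (fun x => c * f x) = c * p.expect f := by
  simp only [expect, Finset.mul_sum]
  exact Finset.sum_congr rfl fun x _ => by ring

lemma expect_mono (p : PMF α) {f g : α → ℝ} (h : ∀ x, f x ≤ g x) : p.expect f ≤ p.expect g :=
  Finset.sum_le_sum fun x _ => mul_le_mul_of_nonneg_left (h x) ENNReal.toReal_nonneg

lemma abs_expect_le (p : PMF α) {f : α → ℝ} {c : ℝ} (h : ∀ x, |f x| ≤ c) : |p.expect f| ≤ c := by
  rw [abs_le]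
  constructor
  · rw [← p.expect_const (-c)]
    exact p.expect_mono fun x => (abs_le.1 (h x)).1
  · rw [← p.expect_const c]
    exact p.expect_mono fun x => (abs_le.1 (h x)).2

lemma expect_pure (a : α) (f : α → ℝ) : (pure a).expect f = f a := by
  classical
  rw [expect, Finset.sum_eq_single a]
  · simp
  · intro b _ hb
    simp [pure_apply, hb]
  · simp

lemma toReal_bind (p : PMF α) (q : α → PMF β) (y : β) :
    (p.bind q y).toReal = ∑ x, (p x).toReal * (q x y).toReal := by
  rw [bind_apply, tsum_fintype, ENNReal.toReal_sum]
  · simp only [ENNReal.toReal_mul]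
  · exact fun x _ => ENNReal.mul_ne_top (p.apply_ne_top x) ((q x).apply_ne_top y)

variable [Fintype β]

lemma expect_bind (p : PMF α) (q : α → PMF β) (f : β → ℝ) :
    (p.bind q).expect f = p.expect fun x => (q x).expect f := by
  simp only [expect, toReal_bind, Finset.sum_mul, Finset.mul_sum]
  rw [Finset.sum_comm]
  exact Finset.sum_congr rfl fun _ _ => Finset.sum_congr rfl fun _ _ => by ring

lemma expect_map (p : PMF α) (g : α → β) (f : β → ℝ) :
    (p.map g).expect f = p.expect fun x => f (g x) := by
  rw [← bind_pure_comp, expect_bind]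
  simp only [Function.comp_apply, expect_pure]

lemma integral_eq_expect [MeasurableSpace α] [MeasurableSingletonClass α] (p : PMF α)
    (f : α → ℝ) : ∫ x, f x ∂p.toMeasure = p.expect f := by
  simp only [PMF.integral_eq_sum, expect, smul_eq_mul]

end expect

end PMF

/-! ### Trajectory integrals as discounted sums over one-time marginals. -/

namespace CMDP

noncomputable section

variable {S A : Type*} {m : ℕ}

/-- The law of `s_t` under `π` when `s_0 ∼ μ`. -/
def lawFrom (M : CMDP S A m) (π : Policy S A) (μ : PMF S) (t : ℕ) : PMF S :=
  (fun μ : PMF S => μ.bind (M.stateStep π))^[t] μ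

lemma lawFrom_zero (M : CMDP S A m) (π : Policy S A) (μ : PMF S) : M.lawFrom π μ 0 = μ := rfl

lemma lawFrom_succ (M : CMDP S A m) (π : Policy S A) (μ : PMF S) (t : ℕ) :
    M.lawFrom π μ (t + 1) = (M.lawFrom π μ t).bind (M.stateStep π) := by
  simp only [lawFrom, Function.iterate_succ_apply']

lemma lawFrom_pure_succ (M : CMDP S A m) (π : Policy S A) (s : S) (t : ℕ) :
    M.lawFrom π (PMF.pure s) (t + 1) = M.lawFrom π (M.stateStep π s) t := by
  simp only [lawFrom, Function.iterate_succ_apply, PMF.pure_bind]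

lemma lawFrom_eq_bind (M : CMDP S A m) (π : Policy S A) (μ : PMF S) (t : ℕ) :
    M.lawFrom π μ t = μ.bind fun s => M.lawFrom π (PMF.pure s) t := by
  induction t with
  | zero => simp only [lawFrom_zero, PMF.bind_pure]
  | succ t ih => simp only [lawFrom_succ, ih, PMF.bind_bind]

lemma saLaw_bind (M : CMDP S A m) (π : Policy S A) (μ : PMF S) :
    ((saLaw π μ).bind fun x => saLaw π (M.P x.1 x.2)) = saLaw π (μ.bind (M.stateStep π)) := by
  simp only [saLaw, stateStep, PMF.bind_bind, PMF.bind_map, Function.comp_def]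

variable [Fintype S] [Fintype A]

lemma expect_saLaw (π : Policy S A) (μ : PMF S) (f : S → A → ℝ) :
    ((saLaw π μ).expect fun x => f x.1 x.2) = μ.expect fun s => (π s).expect (f s) := by
  simp only [saLaw, PMF.expect_bind, PMF.expect_map]

variable [MeasurableSpace S] [MeasurableSingletonClass S]
  [MeasurableSpace A] [MeasurableSingletonClass A]

instance (M : CMDP S A m) (π : Policy S A) (μ : PMF S) :
    IsProbabilityMeasure (M.trajLaw π μ) := by
  have := PMF.toMeasure.isProbabilityMeasure (saLaw π μ)
  unfold trajLaw
  infer_instance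

lemma map_eval_zero_trajLaw (M : CMDP S A m) (π : Policy S A) (μ : PMF S) :
    (M.trajLaw π μ).map (fun ω => ω 0) = (saLaw π μ).toMeasure := by
  have := PMF.toMeasure.isProbabilityMeasure (saLaw π μ)
  have hr : (fun ω : ℕ → S × A => ω 0) =
      (fun h : ((i : Finset.Iic 0) → (fun _ : ℕ => S × A) i) => h ⟨0, Finset.mem_Iic.2 le_rfl⟩) ∘
        Preorder.frestrictLe 0 := rfl
  rw [hr, ← Measure.map_map (by fun_prop) (by fun_prop), trajLaw, Kernel.trajMeasure,
    Measure.map_comp _ _ (by fun_prop), Kernel.traj_map_frestrictLe, Kernel.partialTraj_self,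
    Measure.id_comp, Measure.map_map (by fun_prop) (by fun_prop)]
  exact Measure.map_id

lemma map_eval_succ_trajLaw (M : CMDP S A m) (π : Policy S A) (μ : PMF S) (t : ℕ) :
    (M.trajLaw π μ).map (fun ω => ω (t + 1)) =
      ((M.trajLaw π μ).map (fun ω => ω t)).bind (M.saKernel π) := by
  have := PMF.toMeasure.isProbabilityMeasure (saLaw π μ)
  have h := Kernel.map_frestrictLe_trajMeasure_compProd_eq_map_trajMeasure
    (X := fun _ => S × A) (μ₀ := (saLaw π μ).toMeasure) (κ := M.historyKernel π) (a := t)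
  -- The second marginal of the joint law of the history up to `t` and the next pair; the history
  -- kernel sees only the last pair.
  have h2 := congrArg Measure.snd h
  rw [Measure.snd_compProd, Measure.snd_map_prodMk (by fun_prop)] at h2
  refine Eq.trans h2.symm ?_
  ext B hB
  rw [Measure.bind_apply hB (Kernel.aemeasurable _), Measure.bind_apply hB (Kernel.aemeasurable _),
    lintegral_map (Kernel.measurable_coe _ hB) (by fun_prop),
    lintegral_map (Kernel.measurable_coe _ hB) (by fun_prop)]
  rfl

lemma map_eval_trajLaw (M : CMDP S A m) (π : Policy S A) (μ : PMF S) (t : ℕ) :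
    (M.trajLaw π μ).map (fun ω => ω t) = (saLaw π (M.lawFrom π μ t)).toMeasure := by
  induction t with
  | zero => exact M.map_eval_zero_trajLaw π μ
  | succ t ih =>
    rw [map_eval_succ_trajLaw, ih, lawFrom_succ, ← saLaw_bind]
    ext B hB
    rw [Measure.bind_apply hB (Kernel.aemeasurable _), PMF.toMeasure_bind_apply _ _ _ hB,
      lintegral_fintype, tsum_fintype]
    refine Finset.sum_congr rfl fun x _ => ?_
    rw [PMF.toMeasure_apply_singleton _ _ (measurableSet_singleton x), mul_comm]
    rfl

lemma integral_eval_trajLaw (M : CMDP S A m) (π : Policy S A) (μ : PMF S) (t : ℕ)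
    (f : S → A → ℝ) :
    ∫ ω, f (ω t).1 (ω t).2 ∂(M.trajLaw π μ) =
      (M.lawFrom π μ t).expect fun s => (π s).expect (f s) := by
  rw [← expect_saLaw, ← PMF.integral_eq_expect, ← map_eval_trajLaw,
    integral_map (measurable_pi_apply t).aemeasurable (by fun_prop)]

omit [MeasurableSpace S] [MeasurableSingletonClass S]
  [MeasurableSpace A] [MeasurableSingletonClass A] in
lemma exists_abs_le (f : S → A → ℝ) : ∃ c, 0 ≤ c ∧ ∀ s a, |f s a| ≤ c :=
  ⟨∑ s, ∑ a, |f s a|, by positivity, fun s a =>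
    (Finset.single_le_sum (f := fun a => |f s a|) (fun _ _ => abs_nonneg _)
      (Finset.mem_univ a)).trans
    (Finset.single_le_sum (f := fun s => ∑ a, |f s a|)
      (fun _ _ => Finset.sum_nonneg fun _ _ => abs_nonneg _) (Finset.mem_univ s))⟩

omit [Fintype S] [Fintype A] [MeasurableSpace S] [MeasurableSingletonClass S]
  [MeasurableSpace A] [MeasurableSingletonClass A] in
lemma summable_discount (M : CMDP S A m) {x : ℕ → ℝ} {c : ℝ} (h : ∀ t, |x t| ≤ c) :
    Summable fun t => M.γ ^ t * x t := by
  refine Summable.of_norm_bounded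
    ((summable_geometric_of_lt_one M.γ_pos.le M.γ_lt_one).mul_right c) fun t => ?_
  rw [Real.norm_eq_abs, abs_mul, abs_of_pos (pow_pos M.γ_pos t)]
  exact mul_le_mul_of_nonneg_left (h t) (pow_pos M.γ_pos t).le

/-- Sum and integral may be exchanged because a real function on a finite set is bounded. This
includes `log π`, as `Real.log 0 = 0`. -/
lemma discounted_eq_tsum (M : CMDP S A m) (π : Policy S A) (μ : PMF S) (f : S → A → ℝ) :
    M.discounted π μ f =
      ∑' t, M.γ ^ t * (M.lawFrom π μ t).expect fun s => (π s).expect (f s) := by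
  obtain ⟨c, hc, hf⟩ := exists_abs_le f
  rw [discounted, ← integral_tsum_of_summable_integral_norm]
  · refine tsum_congr fun t => ?_
    rw [integral_const_mul, integral_eval_trajLaw]
  · intro t
    refine (Integrable.of_bound (C := c) ?_ (.of_forall fun ω => hf _ _)).const_mul _
    exact (Measurable.comp (g := fun x : S × A => f x.1 x.2) (by fun_prop)
      (measurable_pi_apply t)).aestronglyMeasurable
  · simp only [norm_mul, norm_pow, integral_const_mul, Real.norm_eq_abs, abs_of_pos M.γ_pos]
    simp only [M.integral_eval_trajLaw π μ _ fun s a => |f s a|]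
    refine M.summable_discount (c := c) fun t => ?_
    exact PMF.abs_expect_le _ fun s => PMF.abs_expect_le _ fun a => by
      rw [abs_abs]; exact hf s a

lemma discounted_eq_expect (M : CMDP S A m) (π : Policy S A) (μ : PMF S) (f : S → A → ℝ) :
    M.discounted π μ f = μ.expect fun s => M.discounted π (PMF.pure s) f := by
  obtain ⟨c, hc, hf⟩ := exists_abs_le f
  simp only [discounted_eq_tsum, PMF.expect]
  simp only [← tsum_mul_left]
  rw [← Summable.tsum_finsetSum]
  · refine tsum_congr fun t => ?_
    rw [lawFrom_eq_bind, ← PMF.expect, PMF.expect_bind, PMF.expect, Finset.mul_sum]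
    refine Finset.sum_congr rfl fun s _ => ?_
    simp only [PMF.expect]
    ring
  · intro s _
    refine Summable.mul_left _ (M.summable_discount (c := c) fun t => ?_)
    exact PMF.abs_expect_le _ fun s => PMF.abs_expect_le _ fun a => hf s a

lemma discounted_pure (M : CMDP S A m) (π : Policy S A) (s : S) (f : S → A → ℝ) :
    M.discounted π (PMF.pure s) f =
      (π s).expect (f s) +
        M.γ * (M.stateStep π s).expect fun s' => M.discounted π (PMF.pure s') f := by
  obtain ⟨c, hc, hf⟩ := exists_abs_le f
  rw [← discounted_eq_expect, discounted_eq_tsum, Summable.tsum_eq_zero_add]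
  · simp only [lawFrom_zero, PMF.expect_pure, lawFrom_pure_succ, pow_zero, one_mul]
    rw [discounted_eq_tsum, ← tsum_mul_left]
    congr 1
    exact tsum_congr fun t => by ring
  · exact M.summable_discount (c := c) fun t =>
      PMF.abs_expect_le _ fun s => PMF.abs_expect_le _ fun a => hf s a

end

end CMDP

/-! ### The soft maximum and Gibbs' inequality. -/

section logSumExp

variable {A : Type*} [Fintype A]

/-- The soft maximum `τ log ∑ exp (x a / τ)`. -/
noncomputable def softMax (τ : ℝ) (x : A → ℝ) : ℝ :=
  τ * Real.log (∑ a, Real.exp (x a / τ))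

lemma sum_exp_pos [Nonempty A] (x : A → ℝ) : 0 < ∑ a, Real.exp (x a) :=
  Finset.sum_pos (fun _ _ => Real.exp_pos _) Finset.univ_nonempty

lemma softMax_le_add [Nonempty A] {τ : ℝ} (hτ : 0 < τ) {x y : A → ℝ} {c : ℝ}
    (h : ∀ a, x a ≤ y a + c) : softMax τ x ≤ softMax τ y + c := by
  have h1 : ∑ a, Real.exp (x a / τ) ≤ Real.exp (c / τ) * ∑ a, Real.exp (y a / τ) := by
    rw [Finset.mul_sum]
    refine Finset.sum_le_sum fun a _ => ?_
    rw [← Real.exp_add, ← add_div]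
    exact Real.exp_le_exp.2 (div_le_div_of_nonneg_right (by linarith [h a]) hτ.le)
  have h2 := Real.log_le_log (sum_exp_pos _) h1
  rw [Real.log_mul (Real.exp_ne_zero _) (sum_exp_pos _).ne', Real.log_exp] at h2
  have h3 := mul_le_mul_of_nonneg_left h2 hτ.le
  rw [mul_add, mul_div_cancel₀ _ hτ.ne'] at h3
  unfold softMax
  linarith

lemma sum_exp_sub_softMax [Nonempty A] {τ : ℝ} (hτ : 0 < τ) (x : A → ℝ) :
    ∑ a, Real.exp ((x a - softMax τ x) / τ) = 1 := by
  have h : ∀ a, Real.exp ((x a - softMax τ x) / τ) =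
      Real.exp (x a / τ) / ∑ a, Real.exp (x a / τ) := fun a => by
    rw [sub_div, Real.exp_sub, softMax, mul_div_cancel_left₀ _ hτ.ne',
      Real.exp_log (sum_exp_pos _)]
  simp only [h, ← Finset.sum_div]
  exact div_self (sum_exp_pos _).ne'

/-- Gibbs' variational inequality. -/
lemma PMF.expect_sub_log_le_softMax [Nonempty A] {τ : ℝ} (hτ : 0 < τ) (p : PMF A) (x : A → ℝ) :
    (p.expect fun a => x a - τ * Real.log (p a).toReal) ≤ softMax τ x := by
  rw [← sub_nonpos, ← p.expect_const (softMax τ x), ← PMF.expect_sub]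
  -- This is `log y ≤ y - 1` at the ratio of the Gibbs weight to `p a`. The right sides sum to zero,
  -- both families of weights having mass one.
  have key : ∀ a, (p a).toReal * (x a - τ * Real.log (p a).toReal - softMax τ x) ≤
      τ * (Real.exp ((x a - softMax τ x) / τ) - (p a).toReal) := by
    intro a
    rcases (ENNReal.toReal_nonneg : 0 ≤ (p a).toReal).eq_or_lt with h | h
    · rw [← h]
      simpa using mul_nonneg hτ.le (Real.exp_pos _).le
    · set q := (p a).toReal
      set e := Real.exp ((x a - softMax τ x) / τ) with he
      have h1 : x a - softMax τ x = τ * Real.log e := by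
        rw [he, Real.log_exp, mul_div_cancel₀ _ hτ.ne']
      have h2 := Real.log_le_sub_one_of_pos (div_pos (Real.exp_pos _ : 0 < e) h)
      rw [Real.log_div (Real.exp_ne_zero _) h.ne'] at h2
      have h3 := mul_le_mul_of_nonneg_left h2 (mul_pos hτ h).le
      have h4 : τ * q * (e / q - 1) = τ * (e - q) := by field_simp
      have h5 : x a - τ * Real.log q - softMax τ x = τ * (Real.log e - Real.log q) := by
        linarith
      rw [h5]
      linarith
  refine (Finset.sum_le_sum fun a _ => key a).trans ?_
  rw [← Finset.mul_sum, Finset.sum_sub_distrib, sum_exp_sub_softMax hτ, p.sum_toReal]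
  simp

end logSumExp

/-! ### Soft Bellman equation and soft optimal policy. -/

namespace CMDP

noncomputable section

variable {S A : Type*} {m : ℕ} [Fintype S] [Fintype A]

omit [Fintype A] in
-- Maximum principle: at a maximiser of `D` the hypothesis reads `D ≤ γ D`. All comparison and
-- uniqueness statements for policy values follow from it.
lemma nonpos_of_le_discount (M : CMDP S A m) (κ : S → PMF S) {D : S → ℝ}
    (h : ∀ s, D s ≤ M.γ * (κ s).expect D) (s : S) : D s ≤ 0 := by
  obtain ⟨s₀, -, hs₀⟩ := Finset.exists_max_image Finset.univ D ⟨s, Finset.mem_univ s⟩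
  have h1 : (κ s₀).expect D ≤ D s₀ :=
    ((κ s₀).expect_mono fun x => hs₀ x (Finset.mem_univ x)).trans_eq ((κ s₀).expect_const _)
  have h2 := (h s₀).trans (mul_le_mul_of_nonneg_left h1 M.γ_pos.le)
  have h3 := M.γ_lt_one
  have h4 : D s₀ ≤ 0 := by nlinarith
  exact (hs₀ s (Finset.mem_univ s)).trans h4

section soft

variable [Nonempty A] (M : CMDP S A m) {τ : ℝ} (hτ : 0 < τ) (R : S → A → ℝ)

/-- The soft Bellman operator for the reward `R`. -/
def softBellman (τ : ℝ) (R : S → A → ℝ) (V : S → ℝ) (s : S) : ℝ :=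
  softMax τ fun a => R s a + M.γ * (M.P s a).expect V

include hτ in
lemma softBellman_le_add {V V' : S → ℝ} {c : ℝ} (h : ∀ s, V s ≤ V' s + c) (s : S) :
    M.softBellman τ R V s ≤ M.softBellman τ R V' s + M.γ * c := by
  refine softMax_le_add hτ fun a => ?_
  have h1 : (M.P s a).expect V ≤ (M.P s a).expect V' + c := by
    refine (PMF.expect_mono _ h).trans_eq ?_
    rw [PMF.expect_add, PMF.expect_const]
  nlinarith [mul_le_mul_of_nonneg_left h1 M.γ_pos.le]

include hτ in
lemma contractingWith_softBellman :
    ContractingWith M.γ.toNNReal (M.softBellman τ R) := by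
  refine ⟨Real.toNNReal_lt_one.2 M.γ_lt_one, LipschitzWith.of_dist_le_mul fun V V' => ?_⟩
  rw [Real.coe_toNNReal _ M.γ_pos.le, dist_pi_le_iff (mul_nonneg M.γ_pos.le dist_nonneg)]
  have h : ∀ s, |V s - V' s| ≤ dist V V' := fun s => by
    rw [← Real.dist_eq]; exact dist_le_pi_dist V V' s
  intro s
  rw [Real.dist_eq, abs_sub_le_iff]
  constructor
  · have := M.softBellman_le_add hτ R (V := V) (V' := V') (c := dist V V')
      (fun s => by linarith [(abs_le.1 (h s)).2]) s
    exact sub_le_iff_le_add'.2 this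
  · have := M.softBellman_le_add hτ R (V := V') (V' := V) (c := dist V V')
      (fun s => by linarith [(abs_le.1 (h s)).1]) s
    exact sub_le_iff_le_add'.2 this

/-- The optimal soft value function for the reward `R`. -/
def softValue : S → ℝ :=
  (M.contractingWith_softBellman hτ R).fixedPoint

/-- The optimal soft action value function for the reward `R`. -/
def softQ (s : S) (a : A) : ℝ :=
  R s a + M.γ * (M.P s a).expect (M.softValue hτ R)

lemma softValue_eq (s : S) : M.softValue hτ R s = softMax τ (M.softQ hτ R s) :=
  (congrFun (M.contractingWith_softBellman hτ R).fixedPoint_isFixedPt s).symm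

/-- The soft optimal policy for the reward `R`. -/
def softPolicy : Policy S A := fun s =>
  PMF.ofFintype (fun a => ENNReal.ofReal
    (Real.exp ((M.softQ hτ R s a - M.softValue hτ R s) / τ))) (by
      rw [← ENNReal.ofReal_sum_of_nonneg fun _ _ => (Real.exp_pos _).le, softValue_eq,
        sum_exp_sub_softMax hτ, ENNReal.ofReal_one])

lemma toReal_softPolicy (s : S) (a : A) :
    (M.softPolicy hτ R s a).toReal =
      Real.exp ((M.softQ hτ R s a - M.softValue hτ R s) / τ) :=
  ENNReal.toReal_ofReal (Real.exp_pos _).le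

end soft

variable [MeasurableSpace S] [MeasurableSingletonClass S]
  [MeasurableSpace A] [MeasurableSingletonClass A]

/-! ### Evaluation of a fixed policy. -/

section policy

variable (M : CMDP S A m) (π π' : Policy S A) (f g : S → A → ℝ)

/-- The value function of the policy `π` for the reward `f`. -/
def polValue (s : S) : ℝ := M.discounted π (PMF.pure s) f

/-- The action value function of the policy `π` for the reward `f`. -/
def polQ (s : S) (a : A) : ℝ := f s a + M.γ * (M.P s a).expect (M.polValue π f)

lemma polValue_eq (s : S) :
    M.polValue π f s = (π s).expect (f s) + M.γ * (M.stateStep π s).expect (M.polValue π f) :=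
  M.discounted_pure π s f

lemma polValue_eq_expect_polQ (s : S) : M.polValue π f s = (π s).expect (M.polQ π f s) := by
  rw [polValue_eq, stateStep, PMF.expect_bind, ← PMF.expect_const_mul, ← PMF.expect_add]
  rfl

variable {M π f} in
lemma le_polValue {X : S → ℝ}
    (h : ∀ s, X s ≤ (π s).expect (f s) + M.γ * (M.stateStep π s).expect X) (s : S) :
    X s ≤ M.polValue π f s := by
  refine sub_nonpos.1 (M.nonpos_of_le_discount (M.stateStep π)
    (D := fun s => X s - M.polValue π f s) (fun s => ?_) s)
  rw [PMF.expect_sub, M.polValue_eq]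
  linarith [h s]

variable {M π f} in
lemma polValue_le {X : S → ℝ}
    (h : ∀ s, (π s).expect (f s) + M.γ * (M.stateStep π s).expect X ≤ X s) (s : S) :
    M.polValue π f s ≤ X s := by
  refine sub_nonpos.1 (M.nonpos_of_le_discount (M.stateStep π)
    (D := fun s => M.polValue π f s - X s) (fun s => ?_) s)
  rw [PMF.expect_sub, M.polValue_eq]
  linarith [h s]

variable {M π f} in
lemma eq_polValue {X : S → ℝ}
    (h : ∀ s, X s = (π s).expect (f s) + M.γ * (M.stateStep π s).expect X) (s : S) :
    X s = M.polValue π f s :=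
  (le_polValue (fun s => (h s).le) s).antisymm (polValue_le (fun s => (h s).ge) s)

lemma polValue_add (s : S) :
    M.polValue π (fun s a => f s a + g s a) s = M.polValue π f s + M.polValue π g s := by
  refine (eq_polValue (X := fun s => M.polValue π f s + M.polValue π g s) (fun s => ?_) s).symm
  rw [PMF.expect_add, PMF.expect_add, M.polValue_eq π f, M.polValue_eq π g]
  ring

lemma polValue_const_mul (c : ℝ) (s : S) :
    M.polValue π (fun s a => c * f s a) s = c * M.polValue π f s := by
  refine (eq_polValue (X := fun s => c * M.polValue π f s) (fun s => ?_) s).symm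
  rw [PMF.expect_const_mul, PMF.expect_const_mul, M.polValue_eq π f]
  ring

lemma polValue_sub (s : S) :
    M.polValue π (fun s a => f s a - g s a) s = M.polValue π f s - M.polValue π g s := by
  refine (eq_polValue (X := fun s => M.polValue π f s - M.polValue π g s) (fun s => ?_) s).symm
  rw [PMF.expect_sub, PMF.expect_sub, M.polValue_eq π f, M.polValue_eq π g]
  ring

variable {f} in
lemma abs_polValue_le {c : ℝ} (h : ∀ s, |(π s).expect (f s)| ≤ c) (s : S) :
    |M.polValue π f s| ≤ c / (1 - M.γ) := by
  have h1 : 1 - M.γ ≠ 0 := (sub_pos.2 M.γ_lt_one).ne'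
  have h2 : c / (1 - M.γ) = c + M.γ * (c / (1 - M.γ)) := by field_simp; ring
  rw [abs_le]
  constructor
  · refine le_polValue (X := fun _ => -(c / (1 - M.γ))) (fun s => ?_) s
    rw [PMF.expect_const]
    linarith [(abs_le.1 (h s)).1]
  · refine polValue_le (X := fun _ => c / (1 - M.γ)) (fun s => ?_) s
    rw [PMF.expect_const]
    linarith [(abs_le.1 (h s)).2]

/-- The performance difference formula. -/
lemma polValue_sub_polValue (s : S) :
    M.polValue π' f s - M.polValue π f s =
      M.polValue π' (fun s _ => (π' s).expect (M.polQ π f s) - (π s).expect (M.polQ π f s)) s := by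
  refine eq_polValue (X := fun s => M.polValue π' f s - M.polValue π f s) (fun s => ?_) s
  rw [PMF.expect_const, PMF.expect_sub, ← M.polValue_eq_expect_polQ π f, M.polValue_eq π' f]
  have h : (π' s).expect (M.polQ π f s) =
      (π' s).expect (f s) + M.γ * (M.stateStep π' s).expect (M.polValue π f) := by
    rw [stateStep, PMF.expect_bind, ← PMF.expect_const_mul, ← PMF.expect_add]
    rfl
  rw [h]
  ring

end policy

/-! ### Optimality of the soft policy. -/

section optimal

variable [Nonempty A] (M : CMDP S A m) {τ : ℝ} (hτ : 0 < τ) (R R' : S → A → ℝ)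

lemma polValue_sub_log_le (π : Policy S A) (s : S) :
    M.polValue π (fun s a => R s a - τ * Real.log (π s a).toReal) s ≤ M.softValue hτ R s := by
  refine polValue_le (fun s => ?_) s
  rw [stateStep, PMF.expect_bind, ← PMF.expect_const_mul, ← PMF.expect_add, softValue_eq]
  refine le_trans (le_of_eq ?_) ((π s).expect_sub_log_le_softMax hτ _)
  congr 1
  ext a
  simp only [softQ]
  ring

lemma polValue_softPolicy (s : S) :
    M.polValue (M.softPolicy hτ R)
      (fun s a => R s a - τ * Real.log (M.softPolicy hτ R s a).toReal) s =
      M.softValue hτ R s := by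
  refine (eq_polValue (fun s => ?_) s).symm
  rw [stateStep, PMF.expect_bind, ← PMF.expect_const_mul, ← PMF.expect_add]
  simp only [toReal_softPolicy, Real.log_exp, mul_div_cancel₀ _ hτ.ne', softQ]
  rw [← (M.softPolicy hτ R s).expect_const (M.softValue hτ R s)]
  congr 1
  ext a
  rw [PMF.expect_const]
  ring

/-- The soft policy for `R` attains the optimum for `R` and is merely a competitor for `R'`; the
entropy terms cancel in the difference. Applied in both orders, this sandwiches the increment of
`softValue`. -/
lemma polValue_le_softValue_sub (s : S) :
    M.polValue (M.softPolicy hτ R) (fun s a => R' s a - R s a) s ≤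
      M.softValue hτ R' s - M.softValue hτ R s := by
  rw [← M.polValue_softPolicy hτ R s]
  have h := M.polValue_sub_log_le hτ R' (M.softPolicy hτ R) s
  rw [polValue_sub] at h ⊢
  rw [polValue_sub]
  linarith

end optimal

end

end CMDP

/-! ### Derivatives with respect to the reward. -/

namespace CMDP

noncomputable section

open Filter Topology

variable {S A : Type*} {m : ℕ} [Fintype S] [Fintype A]
  [MeasurableSpace S] [MeasurableSingletonClass S]
  [MeasurableSpace A] [MeasurableSingletonClass A]

section policy

variable (M : CMDP S A m) (π π' : Policy S A) (f g : S → A → ℝ)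

variable {f} in
lemma abs_polQ_le {c : ℝ} (h : ∀ s a, |f s a| ≤ c) (s : S) (a : A) :
    |M.polQ π f s a| ≤ c / (1 - M.γ) := by
  have h1 : 1 - M.γ ≠ 0 := (sub_pos.2 M.γ_lt_one).ne'
  have h2 : c / (1 - M.γ) = c + M.γ * (c / (1 - M.γ)) := by field_simp; ring
  rw [polQ, h2]
  refine (abs_add_le _ _).trans (add_le_add (h s a) ?_)
  rw [abs_mul, abs_of_pos M.γ_pos]
  exact mul_le_mul_of_nonneg_left (PMF.abs_expect_le _
    (M.abs_polValue_le π fun s => PMF.abs_expect_le _ (h s))) M.γ_pos.le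

lemma abs_polValue_sub_le (s : S) :
    |M.polValue π' f s - M.polValue π f s| ≤
      (∑ s, |(π' s).expect (M.polQ π f s) - (π s).expect (M.polQ π f s)|) / (1 - M.γ) := by
  rw [polValue_sub_polValue]
  refine M.abs_polValue_le π' (fun s => ?_) s
  rw [PMF.expect_const]
  exact Finset.single_le_sum
    (f := fun s => |(π' s).expect (M.polQ π f s) - (π s).expect (M.polQ π f s)|)
    (fun _ _ => abs_nonneg _) (Finset.mem_univ s)

/-- The bound is linear in the size of `f` and otherwise uniform in it, as the envelope theorem
needs: there `f` is the increment `R' - R` itself. -/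
lemma abs_polValue_sub_le_mul {c : ℝ} (h : ∀ s a, |f s a| ≤ c) (s : S) :
    |M.polValue π' f s - M.polValue π f s| ≤
      (∑ s, ∑ a, |(π' s a).toReal - (π s a).toReal|) * (c / (1 - M.γ)) / (1 - M.γ) := by
  refine (M.abs_polValue_sub_le π π' f s).trans
    (div_le_div_of_nonneg_right ?_ (sub_pos.2 M.γ_lt_one).le)
  rw [Finset.sum_mul]
  refine Finset.sum_le_sum fun s _ => ?_
  rw [PMF.expect, PMF.expect, ← Finset.sum_sub_distrib, Finset.sum_mul]
  refine (Finset.abs_sum_le_sum_abs _ _).trans (Finset.sum_le_sum fun a _ => ?_)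
  rw [← sub_mul, abs_mul]
  exact mul_le_mul_of_nonneg_left (M.abs_polQ_le π h s a) (abs_nonneg _)

/-- The value function as a linear function of the reward. -/
def polValueCLM (s : S) : (S → A → ℝ) →L[ℝ] ℝ :=
  LinearMap.toContinuousLinearMap
    { toFun := fun f => M.polValue π f s
      map_add' := fun f g => M.polValue_add π f g s
      map_smul' := fun c f => M.polValue_const_mul π f c s }

lemma polValueCLM_apply (s : S) : M.polValueCLM π s f = M.polValue π f s := rfl

end policy

section derivative

variable [Nonempty A] (M : CMDP S A m) {τ : ℝ} (hτ : 0 < τ) (R R' f h : S → A → ℝ)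

omit [MeasurableSpace S] [MeasurableSingletonClass S]
  [MeasurableSpace A] [MeasurableSingletonClass A] [Nonempty A] in
lemma abs_apply_le_norm (s : S) (a : A) : |f s a| ≤ ‖f‖ :=
  (norm_le_pi_norm (f s) a).trans (norm_le_pi_norm f s)

lemma continuous_softValue (s : S) : Continuous fun R => M.softValue hτ R s := by
  have key : ∀ R R', M.softValue hτ R s - M.softValue hτ R' s ≤ ‖R - R'‖ / (1 - M.γ) := by
    intro R R'
    have h1 := M.polValue_le_softValue_sub hτ R R' s
    have h2 := M.abs_polValue_le (M.softPolicy hτ R) (f := fun s a => R' s a - R s a)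
      (c := ‖R - R'‖) (fun s => PMF.abs_expect_le _ fun a => by
        rw [abs_sub_comm]; exact abs_apply_le_norm (R - R') s a) s
    linarith [(abs_le.1 h2).1]
  refine (LipschitzWith.of_dist_le_mul (K := (1 / (1 - M.γ)).toNNReal) fun R R' => ?_).continuous
  rw [Real.coe_toNNReal _ (one_div_nonneg.2 (sub_pos.2 M.γ_lt_one).le), Real.dist_eq,
    abs_sub_le_iff, dist_eq_norm, one_div_mul_eq_div]
  exact ⟨key R R', norm_sub_rev R R' ▸ key R' R⟩

omit [MeasurableSpace S] [MeasurableSingletonClass S]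
  [MeasurableSpace A] [MeasurableSingletonClass A] [Nonempty A] [Fintype A] in
lemma continuous_expect {X : Type*} [TopologicalSpace X] (p : PMF S) {F : X → S → ℝ}
    (h : ∀ s, Continuous fun x => F x s) : Continuous fun x => p.expect (F x) :=
  continuous_finsetSum _ fun s _ => continuous_const.mul (h s)

lemma continuous_toReal_softPolicy (s : S) (a : A) :
    Continuous fun R => (M.softPolicy hτ R s a).toReal := by
  simp only [toReal_softPolicy, softQ]
  have h1 := M.continuous_softValue hτ s
  have h2 := continuous_expect (M.P s a) fun s => M.continuous_softValue hτ s
  have h3 : Continuous fun R : S → A → ℝ => R s a := by fun_prop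
  exact Real.continuous_exp.comp (((h3.add (continuous_const.mul h2)).sub h1).div_const τ)

lemma continuous_polValue_softPolicy (s : S) :
    Continuous fun R => M.polValue (M.softPolicy hτ R) f s := by
  rw [continuous_iff_continuousAt]
  intro R
  rw [ContinuousAt, tendsto_iff_dist_tendsto_zero]
  refine squeeze_zero (fun _ => dist_nonneg)
    (fun R' => M.abs_polValue_sub_le (M.softPolicy hτ R) (M.softPolicy hτ R') f s) ?_
  have hc : Continuous fun R' => (∑ s, |(M.softPolicy hτ R' s).expect
      (M.polQ (M.softPolicy hτ R) f s) - (M.softPolicy hτ R s).expect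
      (M.polQ (M.softPolicy hτ R) f s)|) / (1 - M.γ) := by
    refine (continuous_finsetSum _ fun s _ => Continuous.abs (Continuous.sub ?_
      continuous_const)).div_const _
    exact continuous_finsetSum _ fun a _ =>
      (M.continuous_toReal_softPolicy hτ s a).mul continuous_const
  simpa using hc.tendsto R

/-- The envelope theorem for the soft value function. -/
lemma hasFDerivAt_softValue (s : S) :
    HasFDerivAt (fun R => M.softValue hτ R s) (M.polValueCLM (M.softPolicy hτ R) s) R := by
  set δ : (S → A → ℝ) → ℝ := fun R' =>
    (∑ s, ∑ a, |(M.softPolicy hτ R' s a).toReal - (M.softPolicy hτ R s a).toReal|) /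
      (1 - M.γ) / (1 - M.γ) with hδ
  have hδc : Continuous δ := by
    refine Continuous.div_const (Continuous.div_const ?_ _) _
    exact continuous_finsetSum _ fun s _ => continuous_finsetSum _ fun a _ =>
      ((M.continuous_toReal_softPolicy hτ s a).sub continuous_const).abs
  have hδ0 : δ R = 0 := by simp [hδ]
  rw [hasFDerivAt_iff_isLittleO, Asymptotics.isLittleO_iff]
  intro c hc
  have hev : ∀ᶠ R' in 𝓝 R, δ R' < c :=
    hδc.continuousAt.eventually_lt_const (hδ0 ▸ hc)
  filter_upwards [hev] with R' hR'
  rw [polValueCLM_apply]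
  have h1 := M.polValue_le_softValue_sub hτ R R' s
  have h2 := M.polValue_le_softValue_sub hτ R' R s
  have h3 := M.abs_polValue_sub_le_mul (M.softPolicy hτ R) (M.softPolicy hτ R') (R' - R)
    (abs_apply_le_norm (R' - R)) s
  -- The sign change turns `h2` into an upper bound by the value of `R' - R` under the policy for
  -- `R'`; `h3` then replaces that policy by the one for `R`, at cost `δ R' * ‖R' - R‖`.
  have h4 := M.polValue_const_mul (M.softPolicy hτ R') (R' - R) (-1) s
  have h5 : (fun s a => -1 * (R' - R) s a) = fun s a => R s a - R' s a := by
    ext s a; simp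
  rw [h5] at h4
  have h6 : (∑ s, ∑ a, |(M.softPolicy hτ R' s a).toReal - (M.softPolicy hτ R s a).toReal|) *
      (‖R' - R‖ / (1 - M.γ)) / (1 - M.γ) = δ R' * ‖R' - R‖ := by
    rw [hδ]; ring
  have h7 : M.polValue (M.softPolicy hτ R) (fun s a => R' s a - R s a) s =
    M.polValue (M.softPolicy hτ R) (R' - R) s := rfl
  rw [h6] at h3
  have h8 := mul_le_mul_of_nonneg_right hR'.le (norm_nonneg (R' - R))
  rw [Real.norm_eq_abs, abs_le]
  constructor
  · have := mul_nonneg hc.le (norm_nonneg (R' - R))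
    linarith
  · linarith [(abs_le.1 h3).2]

lemma hasDerivAt_softValue_line (s : S) (x : ℝ) :
    HasDerivAt (fun x : ℝ => M.softValue hτ (R + x • h) s)
      (M.polValue (M.softPolicy hτ (R + x • h)) h s) x := by
  have h1 : HasDerivAt (fun x : ℝ => R + x • h) h x := by
    simpa using ((hasDerivAt_id x).smul_const h).const_add R
  exact (M.hasFDerivAt_softValue hτ (R + x • h) s).comp_hasDerivAt x h1

lemma hasDerivAt_softPolicy_line (s : S) (a : A) (x : ℝ) :
    HasDerivAt (fun x : ℝ => (M.softPolicy hτ (R + x • h) s a).toReal)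
      ((M.softPolicy hτ (R + x • h) s a).toReal *
        ((M.polQ (M.softPolicy hτ (R + x • h)) h s a -
          M.polValue (M.softPolicy hτ (R + x • h)) h s) / τ)) x := by
  simp only [toReal_softPolicy]
  refine HasDerivAt.exp (HasDerivAt.div_const (HasDerivAt.sub ?_
    (M.hasDerivAt_softValue_line hτ R h s x)) τ)
  have h1 : HasDerivAt (fun x : ℝ => (R + x • h) s a) (h s a) x := by
    simpa using ((hasDerivAt_id x).mul_const (h s a)).const_add (R s a)
  refine h1.add (HasDerivAt.const_mul _ ?_)
  exact HasDerivAt.fun_sum fun s _ => (M.hasDerivAt_softValue_line hτ R h s x).const_mul _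

/-- The derivative of the value function of the soft optimal policy with respect to the reward
that the policy is optimal for. -/
lemma hasDerivAt_polValue_softPolicy_line (s : S) (x : ℝ) :
    HasDerivAt (fun x : ℝ => M.polValue (M.softPolicy hτ (R + x • h)) f s)
      (M.polValue (M.softPolicy hτ (R + x • h))
        (fun s _ => (M.softPolicy hτ (R + x • h) s).expect fun a =>
          (M.polQ (M.softPolicy hτ (R + x • h)) h s a -
            M.polValue (M.softPolicy hτ (R + x • h)) h s) / τ *
          M.polQ (M.softPolicy hτ (R + x • h)) f s a) s) x := by
  set p : ℝ → Policy S A := fun x => M.softPolicy hτ (R + x • h) with hp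
  set F : S → ℝ := fun s => (p x s).expect fun a =>
    (M.polQ (p x) h s a - M.polValue (p x) h s) / τ * M.polQ (p x) f s a with hF
  set E : S → ℝ → ℝ := fun s y => (p y s).expect (M.polQ (p x) f s) with hE
  have hder : ∀ s, HasDerivAt (E s) (F s) x := by
    intro s
    refine (HasDerivAt.fun_sum fun a _ =>
      (M.hasDerivAt_softPolicy_line hτ R h s a x).mul_const (M.polQ (p x) f s a)).congr_deriv ?_
    exact Finset.sum_congr rfl fun a _ => mul_assoc _ _ _
  -- In the performance difference formula `Q` is frozen at `x`, so only the policy weights need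
  -- differentiating.
  have hslope : ∀ y, slope (fun x => M.polValue (p x) f s) x y =
      M.polValue (p y) (fun s _ => slope (E s) x y) s := by
    intro y
    simp only [slope_def_field, div_eq_inv_mul]
    rw [polValue_sub_polValue, ← polValue_const_mul]
  change HasDerivAt (fun x => M.polValue (p x) f s) (M.polValue (p x) (fun s _ => F s) s) x
  rw [hasDerivAt_iff_tendsto_slope, funext hslope]
  have h1 : Tendsto (fun y => M.polValue (p y) (fun s _ => F s) s) (𝓝[≠] x)
      (𝓝 (M.polValue (p x) (fun s _ => F s) s)) := by
    refine Tendsto.mono_left ?_ nhdsWithin_le_nhds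
    have hl : Continuous fun y : ℝ => R + y • h := by fun_prop
    exact ((M.continuous_polValue_softPolicy hτ (fun s _ => F s) s).comp hl).tendsto x
  -- The evaluating policy also moves with `y`, but evaluation is bounded by `1/(1 - γ)` uniformly
  -- over policies.
  have h2 : Tendsto (fun y => M.polValue (p y) (fun s _ => slope (E s) x y) s -
      M.polValue (p y) (fun s _ => F s) s) (𝓝[≠] x) (𝓝 0) := by
    rw [tendsto_zero_iff_abs_tendsto_zero]
    refine squeeze_zero (g := fun y => (∑ s, |slope (E s) x y - F s|) / (1 - M.γ))
      (fun _ => abs_nonneg _) (fun y => ?_) ?_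
    · simp only [Function.comp_apply]
      rw [← polValue_sub]
      refine M.abs_polValue_le _ (fun s => ?_) s
      rw [PMF.expect_const]
      exact Finset.single_le_sum (f := fun s => |slope (E s) x y - F s|)
        (fun _ _ => abs_nonneg _) (Finset.mem_univ s)
    · have h3 : ∀ s, Tendsto (fun y => |slope (E s) x y - F s|) (𝓝[≠] x) (𝓝 0) := fun s => by
        have := ((hasDerivAt_iff_tendsto_slope.1 (hder s)).sub_const (F s)).abs
        simpa using this
      have h4 := (tendsto_finsetSum Finset.univ fun s _ => h3 s).div_const (1 - M.γ)
      simpa using h4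
  simpa using h2.add h1

end derivative

end

end CMDP

/-! ### Oscillation, total variation and covariance. -/

namespace PMF

variable {α : Type*} [Fintype α]

lemma abs_expect_sub_expect_le (p q : PMF α) {f : α → ℝ} {D : ℝ} (h : ∀ x y, |f x - f y| ≤ D) :
    |p.expect f - q.expect f| ≤ D := by
  have h1 : p.expect f - q.expect f = p.expect fun x => q.expect fun y => f x - f y := by
    simp only [expect_sub, expect_const]
  rw [h1]
  exact p.abs_expect_le fun x => q.abs_expect_le fun y => h x y

lemma abs_expect_sub_expect_le_tvDist (p q : PMF α) {f : α → ℝ} {c e : ℝ}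
    (h : ∀ x, |f x - c| ≤ e) :
    |p.expect f - q.expect f| ≤ 2 * e * CMDP.tvDist p q := by
  have h1 : p.expect f - q.expect f = ∑ x, ((p x).toReal - (q x).toReal) * (f x - c) := by
    have h2 : p.expect f - q.expect f =
        p.expect (fun x => f x - c) - q.expect (fun x => f x - c) := by
      simp only [expect_sub, expect_const]
      ring
    rw [h2, expect, expect, ← Finset.sum_sub_distrib]
    exact Finset.sum_congr rfl fun x _ => by ring
  rw [h1, CMDP.tvDist, ← mul_assoc, show 2 * e * (1 / 2) = e by ring, Finset.mul_sum]
  refine (Finset.abs_sum_le_sum_abs _ _).trans (Finset.sum_le_sum fun x _ => ?_)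
  rw [abs_mul, mul_comm]
  exact mul_le_mul_of_nonneg_right (h x) (abs_nonneg _)

/-- By convexity `|x - μ|` lies below its chord over the range of `X`. Taking means leaves `2 (max -
μ)(μ - min)`, at most half the squared range. -/
lemma expect_abs_sub_expect_le [Nonempty α] (p : PMF α) {X : α → ℝ} {D : ℝ}
    (h : ∀ x y, |X x - X y| ≤ D) : (p.expect fun x => |X x - p.expect X|) ≤ D / 2 := by
  obtain ⟨i, hi⟩ := Finite.exists_min X
  obtain ⟨j, hj⟩ := Finite.exists_max X
  have hD := (le_abs_self _).trans (h j i)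
  set μ := p.expect X with hμ
  have hμl : X i ≤ μ := by
    rw [hμ, ← p.expect_const (X i)]; exact p.expect_mono hi
  have hμu : μ ≤ X j := by
    rw [hμ, ← p.expect_const (X j)]; exact p.expect_mono hj
  have key : ∀ x, (X j - X i) * |X x - μ| ≤
      (X j - μ) * (X x - X i) + (μ - X i) * (X j - X x) := by
    intro x
    rcases abs_cases (X x - μ) with ⟨h1, h2⟩ | ⟨h1, h2⟩ <;> rw [h1] <;>
      nlinarith [mul_nonneg (sub_nonneg.2 hμl) (sub_nonneg.2 (hj x)),
        mul_nonneg (sub_nonneg.2 hμu) (sub_nonneg.2 (hi x))]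
  have h1 := p.expect_mono key
  simp only [expect_const_mul, expect_add, expect_sub, expect_const] at h1
  rw [← hμ] at h1
  rcases (hi j).eq_or_lt with h2 | h2
  · have h3 : ∀ x, |X x - μ| ≤ 0 := fun x => by
      rw [abs_nonpos_iff]
      linarith [hi x, hj x]
    have h4 := p.expect_mono h3
    rw [expect_const] at h4
    linarith
  · have h3 : 0 < X j - X i := sub_pos.2 h2
    have h4 : (X j - X i) * (p.expect fun x => |X x - μ|) ≤ (X j - X i) * ((X j - X i) / 2) := by
      nlinarith [sq_nonneg ((X j - μ) - (μ - X i))]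
    linarith [le_of_mul_le_mul_left h4 h3]

/-- Centring `Y` at its midrange does not change the covariance and leaves `|Y - c| ≤ D' / 2`; the
mean absolute deviation of `X` supplies the other half. -/
lemma abs_covariance_le [Nonempty α] (p : PMF α) {X Y : α → ℝ} {D D' : ℝ}
    (h : ∀ x y, |X x - X y| ≤ D) (h' : ∀ x y, |Y x - Y y| ≤ D') :
    |p.expect fun x => (X x - p.expect X) * Y x| ≤ D * D' / 4 := by
  obtain ⟨i, hi⟩ := Finite.exists_min Y
  obtain ⟨j, hj⟩ := Finite.exists_max Y
  have hD := (le_abs_self _).trans (h' j i)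
  have hD0 : 0 ≤ D' := (abs_nonneg _).trans (h' i i)
  set c := (Y i + Y j) / 2 with hc
  have hY : ∀ x, |Y x - c| ≤ D' / 2 := fun x => by
    rw [abs_le]
    constructor <;> linarith [hi x, hj x]
  have h1 : (p.expect fun x => (X x - p.expect X) * Y x) =
      p.expect fun x => (X x - p.expect X) * (Y x - c) := by
    have h2 : ∀ x, (X x - p.expect X) * (Y x - c) =
        (X x - p.expect X) * Y x - c * (X x - p.expect X) := fun x => by ring
    simp only [h2, expect_sub, expect_const_mul, expect_const]
    ring
  have h3 : ∀ x, |(X x - p.expect X) * (Y x - c)| ≤ D' / 2 * |X x - p.expect X| := fun x => by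
    rw [abs_mul, mul_comm]
    exact mul_le_mul_of_nonneg_right (hY x) (abs_nonneg _)
  have h4 := p.expect_mono fun x => (abs_le.1 (h3 x)).2
  have h5 := p.expect_mono fun x => (abs_le.1 (h3 x)).1
  have h6 := mul_le_mul_of_nonneg_left (p.expect_abs_sub_expect_le h) (div_nonneg hD0 zero_le_two)
  simp only [← neg_mul, expect_const_mul] at h4 h5
  rw [h1, abs_le]
  constructor <;> linarith

end PMF

/-! ### Oscillation of value functions under uniform ergodicity. -/

namespace CMDP

noncomputable section

variable {S A : Type*} {m : ℕ}

/-- A bound on the discounted sum of the total variation distances of two state chains that are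
uniformly ergodic with constants `C` and `β`. -/
def mixingSum (γ C β : ℝ) : ℝ := ∑' t : ℕ, γ ^ t * min 1 (2 * C * β ^ t)

lemma summable_mixing (M : CMDP S A m) {C β : ℝ} (hC : 0 < C) (hβ : 0 < β) :
    Summable fun t : ℕ => M.γ ^ t * min 1 (2 * C * β ^ t) :=
  M.summable_discount (c := 1) fun t => by
    rw [abs_of_nonneg (by positivity)]
    exact min_le_left _ _

variable [Fintype S]

lemma tvDist_comm (p q : PMF S) : tvDist p q = tvDist q p := by
  simp only [tvDist, abs_sub_comm]

lemma tvDist_triangle (p q r : PMF S) : tvDist p r ≤ tvDist p q + tvDist q r := by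
  rw [tvDist, tvDist, tvDist, ← mul_add, ← Finset.sum_add_distrib]
  exact mul_le_mul_of_nonneg_left (Finset.sum_le_sum fun s _ => abs_sub_le _ _ _) (by norm_num)

lemma UniformlyErgodic.tvDist_stateLaw_le {M : CMDP S A m} {π : Policy S A} {C β : ℝ}
    (h : M.UniformlyErgodic π C β) (s s' : S) (t : ℕ) :
    tvDist (M.stateLaw π s t) (M.stateLaw π s' t) ≤ 2 * C * β ^ t := by
  obtain ⟨χ, -, hχ⟩ := h
  have h1 := tvDist_triangle (M.stateLaw π s t) χ (M.stateLaw π s' t)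
  have h2 := hχ t s'
  rw [tvDist_comm] at h2
  linarith [hχ t s]

/-- At `t = 0` the point mass at `s` has distance `1 - χ(s)` from `χ`, and two distinct states share
mass at most one. -/
lemma UniformlyErgodic.half_le {M : CMDP S A m} {π : Policy S A} {C β : ℝ}
    (h : M.UniformlyErgodic π C β) (hS : 1 < Fintype.card S) : 1 / 2 ≤ C := by
  classical
  obtain ⟨χ, -, hχ⟩ := h
  obtain ⟨s, s', hne⟩ := Fintype.exists_pair_of_one_lt_card hS
  have key : ∀ s, 1 - (χ s).toReal ≤ C := by
    intro s
    have h1 := PMF.abs_expect_sub_expect_le_tvDist (PMF.pure s) χ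
      (f := fun x => if x = s then 1 else 0) (c := 1 / 2) (e := 1 / 2) (fun x => by
        split_ifs <;> norm_num [abs_of_pos])
    have h2 : χ.expect (fun x => if x = s then 1 else 0) = (χ s).toReal := by
      simp [PMF.expect]
    rw [PMF.expect_pure, h2, if_pos rfl] at h1
    have h3 : tvDist (PMF.pure s) χ ≤ C := by simpa [stateLaw] using hχ 0 s
    linarith [(abs_le.1 h1).2]
  have h1 : (χ s).toReal + (χ s').toReal ≤ 1 := by
    rw [← χ.sum_toReal, ← Finset.sum_pair (f := fun x => (χ x).toReal) hne]
    exact Finset.sum_le_univ_sum_of_nonneg fun _ => ENNReal.toReal_nonneg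
  linarith [key s, key s']

variable [Fintype A] [MeasurableSpace S] [MeasurableSingletonClass S]
  [MeasurableSpace A] [MeasurableSingletonClass A]

section oscillation

variable {M : CMDP S A m} {π : Policy S A} {C β : ℝ} {f g : S → A → ℝ} {c c' e e' : ℝ}

/-- At each time the mean rewards from two starts differ by at most the range `2e`, and also by `2e`
times the distance of the two state laws. The latter is at most `2Cβ^t`, by passing through the
stationary law. -/
lemma UniformlyErgodic.abs_polValue_sub_le (h : M.UniformlyErgodic π C β) (hC : 0 < C)
    (hβ : 0 < β) (hf : ∀ s a, |f s a - c| ≤ e) (s s' : S) :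
    |M.polValue π f s - M.polValue π f s'| ≤ 2 * e * mixingSum M.γ C β := by
  obtain ⟨b, -, hb⟩ := exists_abs_le f
  have hsum : ∀ s, Summable fun t => M.γ ^ t *
      (M.lawFrom π (PMF.pure s) t).expect fun s => (π s).expect (f s) := fun s =>
    M.summable_discount (c := b) fun t =>
      PMF.abs_expect_le _ fun s => PMF.abs_expect_le _ fun a => hb s a
  have he : 0 ≤ 2 * e := by
    obtain ⟨a, -⟩ := (π s).support_nonempty
    linarith [(abs_nonneg _).trans (hf s a)]
  have hE : ∀ s, |(π s).expect (f s) - c| ≤ e := fun s => by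
    rw [← (π s).expect_const c, ← PMF.expect_sub]
    exact PMF.abs_expect_le _ (hf s)
  rw [polValue, polValue, discounted_eq_tsum, discounted_eq_tsum,
    ← (hsum s).tsum_sub (hsum s'), mixingSum, ← tsum_mul_left, ← Real.norm_eq_abs]
  refine tsum_of_norm_bounded ((M.summable_mixing hC hβ).mul_left _).hasSum fun t => ?_
  rw [← mul_sub, Real.norm_eq_abs, abs_mul, abs_of_pos (pow_pos M.γ_pos t), mul_left_comm]
  refine mul_le_mul_of_nonneg_left ?_ (pow_pos M.γ_pos t).le
  rw [mul_min_of_nonneg _ _ he, mul_one]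
  refine le_min (PMF.abs_expect_sub_expect_le _ _ fun x y => ?_) ?_
  · have := abs_sub_le ((π x).expect (f x)) c ((π y).expect (f y))
    rw [abs_sub_comm c] at this
    linarith [hE x, hE y]
  · exact (PMF.abs_expect_sub_expect_le_tvDist _ _ hE).trans
      (mul_le_mul_of_nonneg_left (h.tvDist_stateLaw_le s s' t) he)

lemma UniformlyErgodic.abs_polQ_sub_le (h : M.UniformlyErgodic π C β) (hC : 0 < C)
    (hβ : 0 < β) (hf : ∀ s a, |f s a - c| ≤ e) (s : S) (a a' : A) :
    |M.polQ π f s a - M.polQ π f s a'| ≤ 2 * e * (1 + M.γ * mixingSum M.γ C β) := by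
  have h1 := PMF.abs_expect_sub_expect_le (M.P s a) (M.P s a') (f := M.polValue π f)
    (h.abs_polValue_sub_le hC hβ hf)
  have h2 := mul_le_mul_of_nonneg_left h1 M.γ_pos.le
  have h3 : M.polQ π f s a - M.polQ π f s a' = (f s a - c) - (f s a' - c) +
      M.γ * ((M.P s a).expect (M.polValue π f) - (M.P s a').expect (M.polValue π f)) := by
    simp only [polQ]; ring
  rw [h3]
  refine (abs_add_le _ _).trans ?_
  rw [abs_mul, abs_of_pos M.γ_pos]
  have h4 := abs_sub (f s a - c) (f s a' - c)
  linarith [hf s a, hf s a']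

lemma UniformlyErgodic.abs_polValue_covariance_le [Nonempty A] {τ : ℝ} (hτ : 0 < τ)
    (h : M.UniformlyErgodic π C β)
    (hC : 0 < C) (hβ : 0 < β) (hf : ∀ s a, |f s a - c| ≤ e) (hg : ∀ s a, |g s a - c'| ≤ e')
    (s : S) :
    |M.polValue π (fun s _ => (π s).expect fun a =>
      (M.polQ π g s a - M.polValue π g s) / τ * M.polQ π f s a) s| ≤
      e' * e * (1 + M.γ * mixingSum M.γ C β) ^ 2 / τ / (1 - M.γ) := by
  refine M.abs_polValue_le π (fun s => ?_) s
  rw [PMF.expect_const]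
  have h1 : ∀ a, (M.polQ π g s a - M.polValue π g s) / τ * M.polQ π f s a =
      τ⁻¹ * ((M.polQ π g s a - (π s).expect (M.polQ π g s)) * M.polQ π f s a) := fun a => by
    rw [← polValue_eq_expect_polQ]; ring
  simp only [h1, PMF.expect_const_mul]
  rw [abs_mul, abs_of_pos (inv_pos.2 hτ), inv_mul_eq_div]
  refine div_le_div_of_nonneg_right ?_ hτ.le
  refine ((π s).abs_covariance_le (h.abs_polQ_sub_le hC hβ hg s)
    (h.abs_polQ_sub_le hC hβ hf s)).trans_eq ?_
  ring

end oscillation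

end

end CMDP

/-! ### Comparison of the mixing sum with `L_β`. -/

namespace CMDP

noncomputable section

section mixing

variable {S A : Type*} {m : ℕ}

lemma one_add_mixingSum_le_inv (M : CMDP S A m) {C β : ℝ} (hC : 0 < C) (hβ : 0 < β) :
    1 + M.γ * mixingSum M.γ C β ≤ (1 - M.γ)⁻¹ := by
  have h0 : 1 - M.γ ≠ 0 := (sub_pos.2 M.γ_lt_one).ne'
  have h1 : mixingSum M.γ C β ≤ (1 - M.γ)⁻¹ := by
    rw [mixingSum, ← tsum_geometric_of_lt_one M.γ_pos.le M.γ_lt_one]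
    exact (M.summable_mixing hC hβ).tsum_le_tsum
      (fun t => mul_le_of_le_one_right (pow_pos M.γ_pos t).le (min_le_left _ _))
      (summable_geometric_of_lt_one M.γ_pos.le M.γ_lt_one)
  have h2 : (1 - M.γ)⁻¹ = 1 + M.γ * (1 - M.γ)⁻¹ := by field_simp; ring
  rw [h2]
  linarith [mul_le_mul_of_nonneg_left h1 M.γ_pos.le]

lemma summable_min_geometric {C β : ℝ} (hC : 0 < C) (hβ : 0 < β) (hβ1 : β < 1) :
    Summable fun t : ℕ => min 1 (2 * C * β ^ t) :=
  Summable.of_nonneg_of_le (fun t => by positivity) (fun t => min_le_right _ _)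
    ((summable_geometric_of_lt_one hβ.le hβ1).mul_left _)

lemma tsum_min_geometric_le {C β : ℝ} (hC : 0 < C) (hβ : 0 < β) (hβ1 : β < 1) (n : ℕ) :
    ∑' t : ℕ, min 1 (2 * C * β ^ t) ≤ n + 2 * (C * β ^ n) * (1 - β)⁻¹ := by
  rw [← (summable_min_geometric hC hβ hβ1).sum_add_tsum_nat_add n]
  refine add_le_add ?_ ?_
  · refine (Finset.sum_le_sum fun t _ => min_le_left _ _).trans ?_
    simp
  · rw [← tsum_geometric_of_lt_one hβ.le hβ1, ← tsum_mul_left]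
    refine Summable.tsum_le_tsum (fun t => (min_le_right _ _).trans_eq (by ring))
      ((summable_nat_add_iff n).2 (summable_min_geometric hC hβ hβ1))
      ((summable_geometric_of_lt_one hβ.le hβ1).mul_left _)

/-- The factor 4 is what the quarter in the covariance bound can absorb. For `C ≥ 1` the series is
cut at the ceiling in `L_β`. For `C ≤ 1` that ceiling may be negative, so the whole series is
bounded geometrically and the ceiling from below. -/
lemma tsum_min_geometric_le_Lβ {C β : ℝ} (hC : 1 / 2 ≤ C) (hβ : 0 < β) (hβ1 : β < 1) :
    1 + ∑' t : ℕ, min 1 (2 * C * β ^ t) ≤ 4 * Lβ C β := by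
  have hC0 : 0 < C := by linarith
  have hlogβ : Real.log β < 0 := Real.log_neg hβ hβ1
  have hb : 1 ≤ (1 - β)⁻¹ := (one_le_inv₀ (by linarith)).2 (by linarith)
  have hceil := Int.le_ceil (Real.logb β C⁻¹)
  rw [Lβ]
  rcases le_total 1 C with h1 | h1
  · have hlog : 0 ≤ Real.logb β C⁻¹ := by
      rw [Real.logb, Real.log_inv]
      exact div_nonneg_of_nonpos (neg_nonpos.2 (Real.log_nonneg h1)) hlogβ.le
    obtain ⟨n, hn⟩ := Int.eq_ofNat_of_zero_le (Int.ceil_nonneg hlog)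
    rw [hn] at hceil ⊢
    rw [Int.cast_natCast] at hceil ⊢
    have h2 : C * β ^ n ≤ 1 := by
      have h3 := Real.rpow_le_rpow_of_exponent_ge hβ hβ1.le hceil
      rw [Real.rpow_natCast, Real.rpow_logb hβ hβ1.ne (inv_pos.2 hC0)] at h3
      calc C * β ^ n ≤ C * C⁻¹ := mul_le_mul_of_nonneg_left h3 hC0.le
        _ = 1 := mul_inv_cancel₀ hC0.ne'
    have h4 := tsum_min_geometric_le hC0 hβ hβ1 n
    have h5 : (0 : ℝ) ≤ n := n.cast_nonneg
    nlinarith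
  · have h2 := tsum_min_geometric_le hC0 hβ hβ1 0
    rw [Nat.cast_zero, pow_zero, mul_one, zero_add] at h2
    -- `C/2 - log C` is largest on `[1/2, 1]` at `C = 1/2`, where this tangent bound is exact.
    have h3 : -Real.log C ≤ Real.log 2 + (2 * C)⁻¹ - 1 := by
      have := Real.log_le_sub_one_of_pos (x := (2 * C)⁻¹) (by positivity)
      rw [Real.log_inv, Real.log_mul two_ne_zero hC0.ne'] at this
      linarith
    have h4 : C / 2 - Real.log C ≤ 1 := by
      have h5 := Real.log_two_lt_d9
      have h6 : C / 2 + (2 * C)⁻¹ ≤ 1.3 := by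
        rw [← mul_le_mul_iff_of_pos_right hC0]
        have : (2 * C)⁻¹ * C = 1 / 2 := by field_simp
        nlinarith
      linarith
    -- Since `-log β ≥ 1 - β` and `log C ≤ 0`, the possibly negative logarithm costs at most `|log
    -- C|/(1 - β)`.
    have h7 : Real.log C * (1 - β)⁻¹ ≤ Real.logb β C⁻¹ := by
      have h8 : Real.logb β C⁻¹ = Real.log C * (-Real.log β)⁻¹ := by
        rw [Real.logb, Real.log_inv, inv_neg]; ring
      rw [h8]
      refine mul_le_mul_of_nonpos_left ?_ (Real.log_nonpos hC0.le h1)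
      refine inv_anti₀ (by linarith) ?_
      linarith [Real.log_le_sub_one_of_pos hβ]
    have h9 := mul_le_mul_of_nonneg_right h4 (by linarith : 0 ≤ (1 - β)⁻¹)
    linarith

lemma one_add_mixingSum_le_Lβ (M : CMDP S A m) {C β : ℝ} (hC : 1 / 2 ≤ C) (hβ : 0 < β)
    (hβ1 : β < 1) : 1 + M.γ * mixingSum M.γ C β ≤ 4 * Lβ C β := by
  have hC0 : 0 < C := by linarith
  refine le_trans ?_ (tsum_min_geometric_le_Lβ hC hβ hβ1)
  rw [mixingSum, ← tsum_mul_left]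
  refine add_le_add le_rfl (Summable.tsum_le_tsum (fun t => ?_)
    ((M.summable_mixing hC0 hβ).mul_left _) (summable_min_geometric hC0 hβ hβ1))
  rw [← mul_assoc, ← pow_succ']
  exact mul_le_of_le_one_left (by positivity) (pow_le_one₀ M.γ_pos.le M.γ_lt_one.le)

end mixing

/-! ### The dual function, its gradient and the Lipschitz bound. -/

section multiplier

variable {S A : Type*} {m : ℕ} (M : CMDP S A m)

/-- The combination `∑ vᵢ rᵢ` of the constraint rewards. -/
def constraintReward : EuclideanSpace ℝ (Fin m) →L[ℝ] (S → A → ℝ) :=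
  ∑ i : Fin m, (EuclideanSpace.proj i).smulRight (M.r i.succ)

lemma constraintReward_eq (v : EuclideanSpace ℝ (Fin m)) :
    M.constraintReward v = ∑ i : Fin m, v i • M.r i.succ := by
  simp [constraintReward]

lemma constraintReward_apply (v : EuclideanSpace ℝ (Fin m)) (s : S) (a : A) :
    M.constraintReward v s a = ∑ i : Fin m, v i * M.r i.succ s a := by
  simp [constraintReward_eq]

/-- The reward `r₀ + ∑ λᵢ rᵢ` of the Lagrange function. -/
def lagrangeReward (lam : EuclideanSpace ℝ (Fin m)) : S → A → ℝ :=
  M.r 0 + M.constraintReward lam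

variable [Fintype S] [Fintype A]

lemma le_rMax (i : Fin (m + 1)) (s : S) (a : A) : M.r i s a ≤ M.rMax i :=
  le_ciSup (f := fun x : S × A => M.r i x.1 x.2) (Set.finite_range _).bddAbove (s, a)

/-- Positive rewards lie in `(0, r_max]`, so centring at `r_max / 2` halves the deviation;
Cauchy–Schwarz does the rest. -/
lemma abs_constraintReward_sub_le (v : EuclideanSpace ℝ (Fin m)) (s : S) (a : A) :
    |M.constraintReward v s a - ∑ i, v i * (M.rMax i.succ / 2)| ≤ ‖v‖ * M.RMax / 2 := by
  rw [constraintReward_apply, ← Finset.sum_sub_distrib]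
  have h1 : ∀ i : Fin m, |v i * M.r i.succ s a - v i * (M.rMax i.succ / 2)| ≤
      |v i| * M.rMax i.succ / 2 := fun i => by
    rw [← mul_sub, abs_mul, mul_div_assoc]
    refine mul_le_mul_of_nonneg_left ?_ (abs_nonneg _)
    rw [abs_le]
    constructor <;> linarith [M.r_pos i.succ s a, M.le_rMax i.succ s a]
  refine (Finset.abs_sum_le_sum_abs _ _).trans ((Finset.sum_le_sum fun i _ => h1 i).trans ?_)
  rw [← Finset.sum_div]
  refine div_le_div_of_nonneg_right ?_ zero_le_two
  refine (Real.sum_mul_le_sqrt_mul_sqrt _ _ _).trans_eq ?_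
  simp [EuclideanSpace.norm_eq, RMax]

omit [Fintype S] in
lemma convex_dualDomain (ξ : ℝ) : Convex ℝ (M.dualDomain ξ) := by
  rintro x ⟨hx, hx'⟩ y ⟨hy, hy'⟩ a b ha hb hab
  refine ⟨fun i => add_nonneg (mul_nonneg ha (hx i)) (mul_nonneg hb (hy i)), ?_⟩
  have h1 : ∀ i, |(a • x + b • y) i| ≤ a * |x i| + b * |y i| := fun i => by
    refine (abs_add_le _ _).trans_eq ?_
    simp [abs_mul, abs_of_nonneg ha, abs_of_nonneg hb]
  refine (Finset.sum_le_sum fun i _ => h1 i).trans ?_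
  rw [Finset.sum_add_distrib, ← Finset.mul_sum, ← Finset.mul_sum]
  calc _ ≤ a * M.dualRadius ξ + b * M.dualRadius ξ :=
        add_le_add (mul_le_mul_of_nonneg_left hx' ha) (mul_le_mul_of_nonneg_left hy' hb)
    _ = M.dualRadius ξ := by rw [← add_mul, hab, one_mul]

variable [MeasurableSpace S] [MeasurableSingletonClass S]
  [MeasurableSpace A] [MeasurableSingletonClass A]

lemma lagrangian_eq (τ : ℝ) (π : Policy S A) (lam : EuclideanSpace ℝ (Fin m)) :
    M.lagrangian τ π lam = M.ρ.expect (M.polValue π fun s a =>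
      M.lagrangeReward lam s a - τ * Real.log (π s a).toReal) - inner ℝ lam M.c := by
  have hv : ∀ i, M.value π i = M.ρ.expect (M.polValue π (M.r i)) := fun _ => rfl
  have hc : inner ℝ lam (M.constraintValue π) =
      M.ρ.expect (M.polValue π (M.constraintReward lam)) := by
    have h1 : ∀ s, M.polValue π (M.constraintReward lam) s =
        ∑ i : Fin m, lam i * M.polValue π (M.r i.succ) s := fun s => by
      rw [constraintReward_eq, ← polValueCLM_apply, map_sum]
      simp only [map_smul, polValueCLM_apply, smul_eq_mul]
    rw [funext h1, PiLp.inner_apply]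
    simp only [constraintValue, hv, PMF.expect, Finset.mul_sum]
    rw [Finset.sum_comm]
    simp only [RCLike.inner_apply, conj_trivial, Finset.sum_mul]
    exact Finset.sum_congr rfl fun _ _ => Finset.sum_congr rfl fun _ _ => by ring
  have he : M.entropy π =
      -M.ρ.expect (M.polValue π fun s a => Real.log (π s a).toReal) := by
    rw [entropy, discounted_eq_expect]; rfl
  have h2 : (M.polValue π fun s a =>
      M.lagrangeReward lam s a - τ * Real.log (π s a).toReal) = fun s =>
      M.polValue π (M.r 0) s + M.polValue π (M.constraintReward lam) s -
        τ * M.polValue π (fun s a => Real.log (π s a).toReal) s := by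
    ext s
    rw [polValue_sub, polValue_const_mul, ← polValue_add]
    rfl
  rw [h2, PMF.expect_sub, PMF.expect_add, PMF.expect_const_mul, lagrangian, inner_sub_right, hv,
    hc, he]
  ring

variable [Nonempty A] {τ : ℝ} (hτ : 0 < τ)

lemma lagrangian_softPolicy (lam : EuclideanSpace ℝ (Fin m)) :
    M.lagrangian τ (M.softPolicy hτ (M.lagrangeReward lam)) lam =
      M.ρ.expect (M.softValue hτ (M.lagrangeReward lam)) - inner ℝ lam M.c := by
  rw [lagrangian_eq, funext (M.polValue_softPolicy hτ (M.lagrangeReward lam))]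

lemma isOptimal_softPolicy (lam : EuclideanSpace ℝ (Fin m)) :
    M.IsOptimal τ lam (M.softPolicy hτ (M.lagrangeReward lam)) := by
  intro π
  rw [lagrangian_softPolicy, lagrangian_eq]
  exact sub_le_sub_right (M.ρ.expect_mono (M.polValue_sub_log_le hτ _ π)) _

lemma dual_eq (lam : EuclideanSpace ℝ (Fin m)) :
    M.dual τ lam = M.ρ.expect (M.softValue hτ (M.lagrangeReward lam)) - inner ℝ lam M.c := by
  have h := M.isOptimal_softPolicy hτ lam
  rw [← lagrangian_softPolicy]
  have : Nonempty (Policy S A) := ⟨M.softPolicy hτ (M.lagrangeReward lam)⟩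
  exact (ciSup_le h).antisymm (le_ciSup ⟨_, Set.forall_mem_range.2 h⟩ _)

lemma hasFDerivAt_dual (lam : EuclideanSpace ℝ (Fin m)) :
    HasFDerivAt (M.dual τ)
      ((∑ s, (M.ρ s).toReal • (M.polValueCLM (M.softPolicy hτ (M.lagrangeReward lam)) s ∘L
        M.constraintReward)) - innerSL ℝ M.c) lam := by
  have h1 : M.dual τ = fun lam => M.ρ.expect (M.softValue hτ (M.lagrangeReward lam)) -
      innerSL ℝ M.c lam := by
    ext lam
    rw [dual_eq M hτ, innerSL_apply_apply, real_inner_comm]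
  rw [h1]
  refine HasFDerivAt.sub (HasFDerivAt.fun_sum fun s _ => HasFDerivAt.const_mul ?_ _)
    (innerSL ℝ M.c).hasFDerivAt
  exact (M.hasFDerivAt_softValue hτ (M.lagrangeReward lam) s).comp lam
    (M.constraintReward.hasFDerivAt.const_add (M.r 0))

lemma inner_gradient_dual (lam v : EuclideanSpace ℝ (Fin m)) :
    inner ℝ (∇ (M.dual τ) lam) v =
      M.ρ.expect (M.polValue (M.softPolicy hτ (M.lagrangeReward lam)) (M.constraintReward v)) -
        inner ℝ M.c v := by
  rw [gradient, InnerProductSpace.toDual_symm_apply, (M.hasFDerivAt_dual hτ lam).fderiv]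
  simp [PMF.expect, polValueCLM_apply]

lemma norm_gradient_dual_sub_le {D : Set (EuclideanSpace ℝ (Fin m))} (hD : Convex ℝ D) {C β : ℝ}
    (hC : 1 / 2 ≤ C) (hβ : 0 < β) (hβ1 : β < 1)
    (herg : ∀ lam ∈ D,
      M.UniformlyErgodic (M.softPolicy hτ (M.lagrangeReward lam)) C β)
    {lam lam' : EuclideanSpace ℝ (Fin m)} (hlam : lam ∈ D) (hlam' : lam' ∈ D) :
    ‖∇ (M.dual τ) lam - ∇ (M.dual τ) lam'‖ ≤ M.Ld τ C β * ‖lam - lam'‖ := by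
  set u := ∇ (M.dual τ) lam - ∇ (M.dual τ) lam' with hu
  set w := lam - lam' with hw
  set K := 1 + M.γ * mixingSum M.γ C β with hK
  have hC0 : 0 < C := by linarith
  have hγ : 0 < 1 - M.γ := sub_pos.2 M.γ_lt_one
  have hline : ∀ x : ℝ, M.lagrangeReward lam' + x • M.constraintReward w =
      M.lagrangeReward (lam' + x • w) := fun x => by
    simp only [lagrangeReward, map_add, map_smul, add_assoc]
  -- Up to the constant `⟨c, u⟩`, `φ` is the derivative of the dual in the direction `u` along the
  -- segment, so its total increment is `‖u‖ ^ 2`.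
  set φ : ℝ → ℝ := fun x => M.ρ.expect (M.polValue (M.softPolicy hτ
    (M.lagrangeReward lam' + x • M.constraintReward w)) (M.constraintReward u)) with hφ
  have hder := fun x => HasDerivAt.fun_sum (u := Finset.univ) fun s _ =>
    (M.hasDerivAt_polValue_softPolicy_line hτ (M.lagrangeReward lam') (M.constraintReward u)
      (M.constraintReward w) s x).const_mul (M.ρ s).toReal
  have hmem : ∀ x ∈ Set.Icc (0 : ℝ) 1, lam' + x • w ∈ D := fun x hx => by
    have := hD hlam' hlam (sub_nonneg.2 hx.2) hx.1 (by ring)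
    convert this using 1
    rw [hw, smul_sub, sub_smul, one_smul]
    abel
  have hmvt := norm_image_sub_le_of_norm_deriv_le_segment_01' (f := φ)
    (C := ‖w‖ * M.RMax / 2 * (‖u‖ * M.RMax / 2) * K ^ 2 / τ / (1 - M.γ))
    (fun x _ => (hder x).hasDerivWithinAt) (fun x hx => by
      rw [Real.norm_eq_abs]
      refine M.ρ.abs_expect_le fun s => ?_
      rw [hline]
      exact (herg _ (hmem x ⟨hx.1, hx.2.le⟩)).abs_polValue_covariance_le hτ hC0 hβ
        (M.abs_constraintReward_sub_le u) (M.abs_constraintReward_sub_le w) s)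
  have hφ1 : φ 1 - φ 0 = ‖u‖ ^ 2 := by
    have hi : inner ℝ u u = inner ℝ (∇ (M.dual τ) lam) u - inner ℝ (∇ (M.dual τ) lam') u :=
      inner_sub_left _ _ _
    rw [← real_inner_self_eq_norm_sq, hi, M.inner_gradient_dual hτ, M.inner_gradient_dual hτ]
    have h1 : φ 1 = M.ρ.expect (M.polValue (M.softPolicy hτ (M.lagrangeReward lam))
        (M.constraintReward u)) := by
      simp only [hφ]
      rw [hline, one_smul, hw, add_sub_cancel]
    have h0 : φ 0 = M.ρ.expect (M.polValue (M.softPolicy hτ (M.lagrangeReward lam'))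
        (M.constraintReward u)) := by
      simp only [hφ, zero_smul, add_zero]
    rw [h1, h0]
    ring
  rw [hφ1, Real.norm_eq_abs, abs_of_nonneg (sq_nonneg _)] at hmvt
  have hS0 : 0 ≤ mixingSum M.γ C β := tsum_nonneg fun t =>
    mul_nonneg (pow_pos M.γ_pos t).le (by positivity)
  have hK0 : 0 ≤ K := add_nonneg zero_le_one (mul_nonneg M.γ_pos.le hS0)
  -- Mixing is used in one factor only; the other gives the second power of `1/(1 - γ)` in `L_d`.
  have hK2 : K ^ 2 ≤ 4 * Lβ C β * (1 - M.γ)⁻¹ := by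
    rw [sq]
    exact mul_le_mul (M.one_add_mixingSum_le_Lβ hC hβ hβ1) (M.one_add_mixingSum_le_inv hC0 hβ) hK0
      (hK0.trans (M.one_add_mixingSum_le_Lβ hC hβ hβ1))
  have hfin : ‖u‖ ^ 2 ≤ M.Ld τ C β * ‖w‖ * ‖u‖ := by
    calc ‖u‖ ^ 2 ≤ ‖w‖ * M.RMax / 2 * (‖u‖ * M.RMax / 2) * K ^ 2 / τ / (1 - M.γ) := hmvt
      _ = (‖w‖ * ‖u‖ * M.RMax ^ 2 / 4 / τ / (1 - M.γ)) * K ^ 2 := by ring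
      _ ≤ (‖w‖ * ‖u‖ * M.RMax ^ 2 / 4 / τ / (1 - M.γ)) * (4 * Lβ C β * (1 - M.γ)⁻¹) :=
        mul_le_mul_of_nonneg_left hK2 (by positivity)
      _ = M.Ld τ C β * ‖w‖ * ‖u‖ := by
        rw [Ld]; field_simp
  rcases (norm_nonneg u).eq_or_lt with h0 | h0
  -- If `u = 0` nothing can be cancelled, and `L_d ≥ 0` is needed; `0 ≤ K ≤ 4 L_β` provides it.
  · have hL : 0 ≤ Lβ C β := by
      linarith [hK0.trans (M.one_add_mixingSum_le_Lβ hC hβ hβ1)]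
    rw [← h0, Ld]
    positivity
  · rw [sq] at hfin
    exact le_of_mul_le_mul_right hfin h0

end multiplier

end

end CMDP

theorem proposition2 {S A : Type*} [Fintype S] [Nonempty S] [MeasurableSpace S]
    [MeasurableSingletonClass S] [Fintype A] [Nonempty A] [MeasurableSpace A]
    [MeasurableSingletonClass A] {m : ℕ} (M : CMDP S A m) (τ ξ C β : ℝ)
    (hτ : 0 < τ) (hξ : 0 < ξ) (hC : 0 < C) (hβ : 0 < β) (hβ1 : β < 1)
    -- with a single state every `C > 0` is an ergodicity constant; then it is normalized to `1 ≤ C`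
    (hS : Fintype.card S = 1 → 1 ≤ C)
    (huniq : ∀ lam ∈ M.dualDomain ξ, ∃! π : Policy S A, M.IsOptimal τ lam π)
    (herg : ∀ lam ∈ M.dualDomain ξ, ∀ π : Policy S A, M.IsOptimal τ lam π →
      M.UniformlyErgodic π C β) :
    (∀ lam ∈ M.dualDomain ξ, DifferentiableAt ℝ (M.dual τ) lam) ∧
    ∀ lam ∈ M.dualDomain ξ, ∀ lam' ∈ M.dualDomain ξ,
      ‖∇ (M.dual τ) lam - ∇ (M.dual τ) lam'‖ ≤ M.Ld τ C β * ‖lam - lam'‖ := by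
  refine ⟨fun lam _ => (M.hasFDerivAt_dual hτ lam).differentiableAt,
    fun lam hlam lam' hlam' => ?_⟩
  have herg' : ∀ lam ∈ M.dualDomain ξ,
      M.UniformlyErgodic (M.softPolicy hτ (M.lagrangeReward lam)) C β := fun lam h =>
    herg lam h _ (M.isOptimal_softPolicy hτ lam)
  have hC2 : 1 / 2 ≤ C := by
    rcases (Nat.one_le_iff_ne_zero.2 Fintype.card_ne_zero : 1 ≤ Fintype.card S).eq_or_lt with h | h
    · linarith [hS h.symm]
    · exact (herg' lam hlam).half_le h
  exact M.norm_gradient_dual_sub_le hτ (M.convex_dualDomain ξ) hC2 hβ hβ1 herg' hlam hlam'
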